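/- Let $n\in\mathbb{N}$ and write $\alpha!=\alpha_1!\cdots\alpha_n!$, $t^\alpha=t_1^{\alpha_1}\cdots t_n^{\alpha_n}$, $\partial^\alpha=\partial_{x_1}^{\alpha_1}\cdots\partial_{x_n}^{\alpha_n}$ for $\alpha\in\mathbb{N}_0^n$, with $\beta\le\alpha$ understood componentwise. Let $P\subset\mathbb{R}[x_1,\dots,x_n]$ be the set of polynomials that are non-negative on all of $\mathbb{R}^n$, and let $P_\alpha$ be the set of $f\in P$ with $\deg_{x_i}f\le\alpha_i$ for all $i$. For real polynomials $f=\sum_\alpha a_\alpha x^\alpha$ and $g=\sum_\alpha b_\alpha x^\alpha$ let $\langle f,g\rangle=\sum_\alpha \alpha!\,a_\alpha b_\alpha$ be their Fischer–Fock inner product. Let $T:\mathbb{R}[x_1,\dots,x_n]\to\mathbb{R}[x_1,\dots,x_n]$ be any linear operator and let $T=\sum_{\alpha\in\mathbb{N}_0^n}q_\alpha(x)\,\partial^\alpha$, $q_\alpha\in\mathbb{R}[x_1,\dots,x_n]$, be its unique expression as a differential operator of possibly infinite order. For $y\in\mathbb{R}^n$ and $\alpha\in\mathbb{N}_0^n$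 put $$T_y=\sum_{\alpha}q_\alpha(y)\,\partial^\alpha,\qquad p_{y,\alpha}(x)=\sum_{\beta\le\alpha}q_\beta(y)\,x^\beta,\qquad H_y(\alpha)=\alpha!\,q_\alpha(y).$$ Then the following are equivalent: (1) $T(P)\subseteq P$; (2) $T_y(P)\subseteq P$ for all $y\in\mathbb{R}^n$; (3) $\langle p_{y,2\alpha},f\rangle\ge 0$ for all $y\in\mathbb{R}^n$, $\alpha\in\mathbb{N}_0^n$ and $f\in P_{2\alpha}$, i.e. $p_{y,2\alpha}$ lies in the dual cone of $P_{2\alpha}$ with respect to $\langle\cdot,\cdot\rangle$; (4) there are non-negative Borel measures $\mu_s$ on $\mathbb{R}^n$, $s\in\mathbb{R}^n$, with $\int|t^\alpha|\,d\mu_s(t)<\infty$ for all $s$ and $\alpha$, such that for each $\alpha\in\mathbb{N}_0^n$ the moment $\int t^\alpha\,d\mu_s(t)$ is a polynomial in $s$, and $H_y(\alpha)=\int t^\alpha\,d\mu_y(t)$ for all $y\in\mathbb{R}^n$ and $\alpha\in\mathbb{N}_0^n$. For every family $(\mu_s)$ as in (4), the operators $T_y$ are the convolutions $$T_y(f)(x)=\int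 f(t+x)\,d\mu_y(t),\qquad f\in\mathbb{R}[x_1,\dots,x_n],\ x,y\in\mathbb{R}^n,$$ where the integrals converge absolutely. Furthermore, each of the conditions (1)–(4) implies: (5) for each $y\in\mathbb{R}^n$, $H_y$ is a positive semidefinite kernel, i.e. the matrix $\big(H_y(\alpha^i+\alpha^j)\big)_{i,j=1}^m$ is positive semidefinite for all $m\in\mathbb{N}$ and $\alpha^1,\dots,\alpha^m\in\mathbb{N}_0^n$. -/

import Mathlib

open MvPolynomial MeasureTheory

namespace NonnegPreserver

/-- The product of the factorials of the entries of a multi-index. -/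
def multiFactorial {n : ℕ} (α : Fin n →₀ ℕ) : ℕ := ∏ i, (α i).factorial

/-- The partial derivative `∂₁^{α₁} ⋯ ∂ₙ^{αₙ}` on real polynomials in `n` variables. -/
noncomputable def multiDeriv {n : ℕ} (α : Fin n →₀ ℕ) :
    Module.End ℝ (MvPolynomial (Fin n) ℝ) :=
  ((List.finRange n).map fun i =>
    ((pderiv i : Derivation ℝ (MvPolynomial (Fin n) ℝ) (MvPolynomial (Fin n) ℝ)) :
      Module.End ℝ (MvPolynomial (Fin n) ℝ)) ^ α i).prod

theorem pderiv_pow_monomial {n : ℕ} (i : Fin n) (k : ℕ) (β : Fin n →₀ ℕ) (c : ℝ) :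
    (((pderiv i : Derivation ℝ (MvPolynomial (Fin n) ℝ) (MvPolynomial (Fin n) ℝ)) :
      Module.End ℝ (MvPolynomial (Fin n) ℝ)) ^ k) (monomial β c) =
      monomial (β - Finsupp.single i k) (c * ((β i).descFactorial k : ℝ)) := by
  induction k with
  | zero => simp
  | succ k ih =>
    rw [pow_succ', Module.End.mul_apply, ih]
    simp only [Derivation.coeFn_coe, pderiv_monomial]
    congr 1
    · rw [tsub_tsub, ← Finsupp.single_add]
    · rw [Nat.descFactorial_succ]
      simp only [Finsupp.coe_tsub, Pi.sub_apply, Finsupp.single_eq_same]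
      push_cast
      ring

theorem multiDeriv_monomial {n : ℕ} (α β : Fin n →₀ ℕ) (c : ℝ) :
    multiDeriv α (monomial β c) =
      monomial (β - α) (c * ∏ i, ((β i).descFactorial (α i) : ℝ)) := by
  have key : ∀ l : List (Fin n), l.Nodup →
      ((l.map fun i =>
        ((pderiv i : Derivation ℝ (MvPolynomial (Fin n) ℝ) (MvPolynomial (Fin n) ℝ)) :
          Module.End ℝ (MvPolynomial (Fin n) ℝ)) ^ α i).prod) (monomial β c) =
      monomial (β - (l.map fun i => Finsupp.single i (α i)).sum)
        (c * (l.map fun i => ((β i).descFactorial (α i) : ℝ)).prod) := by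
    intro l
    induction l with
    | nil => intro _; simp
    | cons i l ih =>
      intro hl
      rw [List.nodup_cons] at hl
      have h0 : ((l.map fun i => Finsupp.single i (α i)).sum) i = 0 := by
        have : ∀ l' : List (Fin n), i ∉ l' →
            ((l'.map fun i => Finsupp.single i (α i)).sum) i = 0 := by
          intro l' hl'
          induction l' with
          | nil => simp
          | cons j l' ih' =>
            simp only [List.mem_cons, not_or] at hl'
            simp only [List.map_cons, List.sum_cons, Finsupp.add_apply, ih' hl'.2, add_zero]
            exact Finsupp.single_eq_of_ne hl'.1
        exact this l hl.1
      rw [List.map_cons, List.prod_cons, Module.End.mul_apply, ih hl.2, pderiv_pow_monomial]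
      congr 1
      · rw [tsub_tsub, List.map_cons, List.sum_cons, add_comm]
      · simp only [Finsupp.coe_tsub, Pi.sub_apply, h0, List.map_cons, List.prod_cons]
        simp only [tsub_zero]
        ring
  rw [multiDeriv, key _ (List.nodup_finRange n)]
  have h1 : ((List.finRange n).map fun i => Finsupp.single i (α i)).sum = α := by
    rw [← List.ofFn_eq_map, List.sum_ofFn]
    exact Finsupp.univ_sum_single α
  have h2 : ((List.finRange n).map fun i => ((β i).descFactorial (α i) : ℝ)).prod =
      ∏ i, ((β i).descFactorial (α i) : ℝ) := by
    rw [← List.ofFn_eq_map, List.prod_ofFn]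
  rw [h1, h2]

theorem multiDeriv_monomial_eq_zero {n : ℕ} {α β : Fin n →₀ ℕ} (h : ¬ α ≤ β) (c : ℝ) :
    multiDeriv α (monomial β c) = 0 := by
  rw [multiDeriv_monomial]
  have : ∃ i, ¬ α i ≤ β i := by
    by_contra hc
    push Not at hc
    exact h hc
  obtain ⟨i, hi⟩ := this
  rw [Finset.prod_eq_zero (Finset.mem_univ i)]
  · simp
  · rw [Nat.descFactorial_eq_zero_iff_lt.2 (not_le.1 hi), Nat.cast_zero]

theorem multiDeriv_monomial_self {n : ℕ} (β : Fin n →₀ ℕ) :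
    multiDeriv β (monomial β 1) = C (multiFactorial β : ℝ) := by
  rw [multiDeriv_monomial, tsub_self, multiFactorial]
  simp [Nat.descFactorial_self]

theorem finite_multiDeriv_ne_zero {n : ℕ} (f : MvPolynomial (Fin n) ℝ) :
    {α : Fin n →₀ ℕ | multiDeriv α f ≠ 0}.Finite := by
  induction f using MvPolynomial.monomial_add_induction_on with
  | C a =>
    refine (Set.finite_Iic (0 : Fin n →₀ ℕ)).subset fun α hα => ?_
    by_contra hc
    exact hα (multiDeriv_monomial_eq_zero hc a)
  | monomial_add β c f _ _ ih =>
    refine ((Set.finite_Iic β).union ih).subset fun α hα => ?_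
    by_contra hc
    simp only [Set.mem_union, Set.mem_Iic, Set.mem_ofPred_eq, not_or, not_not] at hc
    exact hα (by rw [map_add, multiDeriv_monomial_eq_zero hc.1, hc.2, add_zero])

theorem finite_support_term {n : ℕ} (q : (Fin n →₀ ℕ) → MvPolynomial (Fin n) ℝ)
    (f : MvPolynomial (Fin n) ℝ) :
    (Function.support fun α => q α * multiDeriv α f).Finite :=
  (finite_multiDeriv_ne_zero f).subset fun α hα h0 => hα (by
    show q α * multiDeriv α f = 0
    rw [h0, mul_zero])

/-- The differential operator `∑_α q_α(x) ∂^α` of possibly infinite order; the sum is finite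
on every polynomial. -/
noncomputable def diffOp {n : ℕ} (q : (Fin n →₀ ℕ) → MvPolynomial (Fin n) ℝ) :
    MvPolynomial (Fin n) ℝ →ₗ[ℝ] MvPolynomial (Fin n) ℝ where
  toFun f := ∑ᶠ α, q α * multiDeriv α f
  map_add' f g := by
    rw [← finsum_add_distrib (finite_support_term q f) (finite_support_term q g)]
    simp only [map_add, mul_add]
  map_smul' c f := by
    rw [RingHom.id_apply, smul_finsum' c (finite_support_term q f)]
    simp only [map_smul, mul_smul_comm]

theorem diffOp_monomial {n : ℕ} (q : (Fin n →₀ ℕ) → MvPolynomial (Fin n) ℝ)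
    (β : Fin n →₀ ℕ) :
    diffOp q (monomial β 1) =
      q β * C (multiFactorial β : ℝ) +
        ∑ α ∈ Finset.Iio β, q α * multiDeriv α (monomial β 1) := by
  have h : diffOp q (monomial β 1) =
      ∑ α ∈ Finset.Iic β, q α * multiDeriv α (monomial β 1) := by
    refine finsum_eq_sum_of_support_subset _ fun α hα => ?_
    by_contra hc
    simp only [Finset.coe_Iic, Set.mem_Iic] at hc
    exact hα (by
      show q α * multiDeriv α (monomial β 1) = 0
      rw [multiDeriv_monomial_eq_zero hc, mul_zero])
  rw [h, ← Finset.Iio_insert, Finset.sum_insert (by simp), multiDeriv_monomial_self]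

theorem C_multiFactorial_mul_inv {n : ℕ} (β : Fin n →₀ ℕ) :
    (C ((multiFactorial β : ℝ)⁻¹) : MvPolynomial (Fin n) ℝ) * C (multiFactorial β : ℝ) = 1 := by
  have h : (multiFactorial β : ℝ) ≠ 0 := by
    rw [multiFactorial]
    exact_mod_cast Finset.prod_ne_zero_iff.2 fun i _ => Nat.factorial_ne_zero _
  rw [← C_mul, inv_mul_cancel₀ h, C_1]

/-- Every linear operator on real polynomials has exactly one expression `∑_α q_α(x) ∂^α`. -/
theorem existsUnique_diffOp {n : ℕ}
    (T : MvPolynomial (Fin n) ℝ →ₗ[ℝ] MvPolynomial (Fin n) ℝ) :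
    ∃! q : (Fin n →₀ ℕ) → MvPolynomial (Fin n) ℝ, T = diffOp q := by
  have hex : ∃ q : (Fin n →₀ ℕ) → MvPolynomial (Fin n) ℝ, ∀ β,
      q β = C ((multiFactorial β : ℝ)⁻¹) *
        (T (monomial β 1) - ∑ α ∈ Finset.Iio β, q α * multiDeriv α (monomial β 1)) := by
    let F : (β : Fin n →₀ ℕ) → ((α : Fin n →₀ ℕ) → α < β → MvPolynomial (Fin n) ℝ) →
        MvPolynomial (Fin n) ℝ := fun β r => C ((multiFactorial β : ℝ)⁻¹) *
          (T (monomial β 1) - ∑ α ∈ (Finset.Iio β).attach,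
            r α.1 (Finset.mem_Iio.1 α.2) * multiDeriv α.1 (monomial β 1))
    refine ⟨(wellFounded_lt (α := Fin n →₀ ℕ)).fix F, fun β => ?_⟩
    rw [WellFounded.fix_eq]
    show C _ * (_ - _) = _
    rw [Finset.sum_attach (Finset.Iio β) fun α =>
      (wellFounded_lt (α := Fin n →₀ ℕ)).fix F α * multiDeriv α (monomial β 1)]
  obtain ⟨q, hq⟩ := hex
  refine ⟨q, ?_, fun q' hq' => ?_⟩
  · refine (basisMonomials (Fin n) ℝ).ext fun β => ?_
    rw [coe_basisMonomials, diffOp_monomial]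
    have := hq β
    generalize ∑ α ∈ Finset.Iio β, q α * multiDeriv α (monomial β 1) = S at this ⊢
    rw [this]
    linear_combination (-(T (monomial β 1) - S)) * C_multiFactorial_mul_inv β
  · funext β
    induction β using WellFoundedLT.induction with
    | ind β ih =>
      have h1 : T (monomial β 1) = diffOp q' (monomial β 1) := by rw [hq']
      rw [diffOp_monomial] at h1
      have h2 : ∑ α ∈ Finset.Iio β, q' α * multiDeriv α (monomial β 1) =
          ∑ α ∈ Finset.Iio β, q α * multiDeriv α (monomial β 1) :=
        Finset.sum_congr rfl fun α hα => by rw [ih α (Finset.mem_Iio.1 hα)]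
      rw [hq β, h1, h2]
      linear_combination (-(q' β)) * C_multiFactorial_mul_inv β

/-- The coefficients `q_α` in the unique expression `T = ∑_α q_α(x) ∂^α`. -/
noncomputable def symbolCoeff {n : ℕ}
    (T : MvPolynomial (Fin n) ℝ →ₗ[ℝ] MvPolynomial (Fin n) ℝ) :
    (Fin n →₀ ℕ) → MvPolynomial (Fin n) ℝ :=
  (existsUnique_diffOp T).choose

theorem eq_diffOp_symbolCoeff {n : ℕ}
    (T : MvPolynomial (Fin n) ℝ →ₗ[ℝ] MvPolynomial (Fin n) ℝ) : T = diffOp (symbolCoeff T) :=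
  (existsUnique_diffOp T).choose_spec.1

/-- The constant-coefficient operator `T_y = ∑_α q_α(y) ∂^α`. -/
noncomputable def frozenOp {n : ℕ}
    (T : MvPolynomial (Fin n) ℝ →ₗ[ℝ] MvPolynomial (Fin n) ℝ) (y : Fin n → ℝ) :
    MvPolynomial (Fin n) ℝ →ₗ[ℝ] MvPolynomial (Fin n) ℝ :=
  diffOp fun α => C (eval y (symbolCoeff T α))

/-- The polynomial `p_{y,α}(x) = ∑_{β ≤ α} q_β(y) x^β`. -/
noncomputable def truncatedSymbol {n : ℕ}
    (T : MvPolynomial (Fin n) ℝ →ₗ[ℝ] MvPolynomial (Fin n) ℝ) (y : Fin n → ℝ)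
    (α : Fin n →₀ ℕ) : MvPolynomial (Fin n) ℝ :=
  ∑ β ∈ Finset.Iic α, monomial β (eval y (symbolCoeff T β))

/-- The map `H_y(α) = α! q_α(y)`. -/
noncomputable def hankelMap {n : ℕ}
    (T : MvPolynomial (Fin n) ℝ →ₗ[ℝ] MvPolynomial (Fin n) ℝ) (y : Fin n → ℝ)
    (α : Fin n →₀ ℕ) : ℝ :=
  multiFactorial α * eval y (symbolCoeff T α)

/-- The cone of polynomials that are non-negative on all of `ℝⁿ`. -/
def nonnegCone (n : ℕ) : Set (MvPolynomial (Fin n) ℝ) := {f | ∀ x, 0 ≤ eval x f}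

/-- The non-negative polynomials of degree at most `α i` in the `i`-th variable. -/
def nonnegConeLE {n : ℕ} (α : Fin n →₀ ℕ) : Set (MvPolynomial (Fin n) ℝ) :=
  {f | f ∈ nonnegCone n ∧ ∀ i, f.degreeOf i ≤ α i}

/-- The Fischer–Fock inner product `∑_α α! a_α b_α` of `∑_α a_α x^α` and `∑_α b_α x^α`. -/
noncomputable def fischerInner {n : ℕ} (f g : MvPolynomial (Fin n) ℝ) : ℝ :=
  ∑ α ∈ f.support, (multiFactorial α : ℝ) * f.coeff α * g.coeff α

/-- The dual of a cone of polynomials with respect to the Fischer–Fock inner product. -/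
def fischerDual {n : ℕ} (K : Set (MvPolynomial (Fin n) ℝ)) : Set (MvPolynomial (Fin n) ℝ) :=
  {f | ∀ g ∈ K, 0 ≤ fischerInner f g}

/-- All moments of the measure on `ℝⁿ` are finite. -/
def HasFiniteMoments {n : ℕ} (μ : Measure (Fin n → ℝ)) : Prop :=
  ∀ α : Fin n →₀ ℕ, Integrable (fun t : Fin n → ℝ => ∏ i, t i ^ α i) μ

/-- The family `(μ_s)` consists of measures with all moments finite, each moment is a polynomial
in `s`, and `H_y` is the moment sequence of `μ_y` for each `y`. -/
def IsMomentFamily {n : ℕ}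
    (T : MvPolynomial (Fin n) ℝ →ₗ[ℝ] MvPolynomial (Fin n) ℝ)
    (μ : (Fin n → ℝ) → Measure (Fin n → ℝ)) : Prop :=
  (∀ s, HasFiniteMoments (μ s)) ∧
  (∀ α : Fin n →₀ ℕ, ∃ m : MvPolynomial (Fin n) ℝ,
    ∀ s, ∫ t, ∏ i, t i ^ α i ∂(μ s) = eval s m) ∧
  (∀ y, ∀ α : Fin n →₀ ℕ, hankelMap T y α = ∫ t, ∏ i, t i ^ α i ∂(μ y))

end NonnegPreserver

/-! Everything reduces to the functionals `L_y f = (T_y f)(0)`: each of (1)–(4) says that every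
`L_y` is non-negative on the cone `P`. Since `T_y` has constant coefficients, it commutes with
translations, so `(T_y f)(x) = L_y (f(· + x))`; moreover `(T f)(y) = (T_y f)(y)`. As `P` is
translation invariant, (1) and (2) follow from, and give back, positivity of all `L_y`. On monomials
`L_y` takes the values `H_y`, and the factorial weights of the Fischer–Fock product turn pairing
with `p_{y,2α}` into `L_y` on polynomials of degree at most `2α`; this is (3). For (4), Haviland's
theorem (`exists_measure_integral_eval_eq`) represents each `L_y` by a measure. Testing `L_y` on
squares gives (5). -/

namespace NonnegPreserver

open Filter Topology CompactlySupported

/-! ### Cutoff functions and Haviland's theorem -/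

/-- The polynomial `∑ i, x_i ^ 2`. -/
noncomputable def sumSq (n : ℕ) : MvPolynomial (Fin n) ℝ := ∑ i, X i ^ 2

theorem eval_sumSq {n : ℕ} (x : Fin n → ℝ) : eval x (sumSq n) = ∑ i, x i ^ 2 := by
  simp [sumSq]

theorem eval_sumSq_nonneg {n : ℕ} (x : Fin n → ℝ) : 0 ≤ eval x (sumSq n) := by
  rw [eval_sumSq]
  positivity

theorem isCompact_eval_sumSq_le {n : ℕ} (r : ℝ) :
    IsCompact {x : Fin n → ℝ | eval x (sumSq n) ≤ r} := by
  refine Metric.isCompact_of_isClosed_isBounded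
    (isClosed_le (MvPolynomial.continuous_eval _) continuous_const) ?_
  refine (Metric.isBounded_closedBall (x := (0 : Fin n → ℝ)) (r := 1 + r)).subset fun x hx => ?_
  have hx' : eval x (sumSq n) ≤ r := hx
  have h0 := eval_sumSq_nonneg x
  rw [mem_closedBall_zero_iff, pi_norm_le_iff_of_nonneg (by linarith)]
  intro i
  have h1 : x i ^ 2 ≤ ∑ j, x j ^ 2 :=
    Finset.single_le_sum (fun j _ => sq_nonneg (x j)) (Finset.mem_univ i)
  rw [eval_sumSq] at hx'
  rw [Real.norm_eq_abs]
  nlinarith [sq_abs (x i), sq_nonneg (|x i| - 1), abs_nonneg (x i)]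

/-- A continuous cutoff function, equal to `1` where `∑ i, x_i ^ 2 ≤ k` and to `0` where
`k + 1 ≤ ∑ i, x_i ^ 2`. -/
noncomputable def cutoff {n : ℕ} (k : ℕ) (x : Fin n → ℝ) : ℝ :=
  max 0 (min 1 (k + 1 - eval x (sumSq n)))

theorem continuous_cutoff {n : ℕ} (k : ℕ) : Continuous (cutoff (n := n) k) :=
  continuous_const.max (continuous_const.min
    (continuous_const.sub (MvPolynomial.continuous_eval _)))

theorem cutoff_nonneg {n : ℕ} (k : ℕ) (x : Fin n → ℝ) : 0 ≤ cutoff k x := le_max_left _ _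

theorem cutoff_le_one {n : ℕ} (k : ℕ) (x : Fin n → ℝ) : cutoff k x ≤ 1 :=
  max_le zero_le_one (min_le_left _ _)

theorem monotone_cutoff {n : ℕ} (x : Fin n → ℝ) : Monotone fun k => cutoff k x := by
  intro k l h
  have : (k : ℝ) ≤ l := Nat.cast_le.2 h
  exact max_le_max_left _ (min_le_min_left _ (by linarith))

/-- In `s = ∑ i, x_i ^ 2` the left side is the ramp from `0` at `k` to `1` at `k + 1`, which stays
below the line through the origin and `(k + 1, 1)`. A polynomial bound is needed so that `L` itself
can control the cutoff error. -/
theorem one_sub_cutoff_le {n : ℕ} (k : ℕ) (x : Fin n → ℝ) :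
    1 - cutoff k x ≤ eval x (sumSq n) / (k + 1) := by
  have hk : (0 : ℝ) ≤ k := Nat.cast_nonneg k
  have h0 := eval_sumSq_nonneg x
  rw [le_div_iff₀ (by positivity), cutoff]
  generalize eval x (sumSq n) = s at h0
  rcases le_total s k with h | h
  · rw [min_eq_left (by linarith), max_eq_right zero_le_one]
    linarith
  rcases le_total s (k + 1) with h' | h'
  · rw [min_eq_right (by linarith), max_eq_right (by linarith)]
    nlinarith
  · rw [min_eq_right (by linarith), max_eq_left (by linarith)]
    linarith

theorem tendsto_cutoff {n : ℕ} (x : Fin n → ℝ) :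
    Tendsto (fun k : ℕ => cutoff k x) atTop (𝓝 1) := by
  refine tendsto_of_tendsto_of_tendsto_of_le_of_le (g := fun k : ℕ =>
    1 - eval x (sumSq n) / ((k : ℝ) + 1)) (h := fun _ => 1) ?_ tendsto_const_nhds
    (fun k => by have := one_sub_cutoff_le k x; dsimp only; linarith) (fun k => cutoff_le_one k x)
  simpa [div_eq_mul_inv] using
    ((tendsto_one_div_add_atTop_nhds_zero_nat (𝕜 := ℝ)).const_mul (eval x (sumSq n))).const_sub 1

/-- The compactly supported function `x ↦ f(x) · cutoff k x`. -/
noncomputable def cutoffMul {n : ℕ} (f : MvPolynomial (Fin n) ℝ) (k : ℕ) :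
    C_c(Fin n → ℝ, ℝ) where
  toFun x := eval x f * cutoff k x
  continuous_toFun := (MvPolynomial.continuous_eval f).mul (continuous_cutoff k)
  hasCompactSupport' := by
    refine HasCompactSupport.intro (isCompact_eval_sumSq_le (k + 1 : ℝ)) fun x hx => ?_
    have hx' : (k + 1 : ℝ) < eval x (sumSq n) := not_le.1 hx
    rw [cutoff, min_eq_right (by linarith), max_eq_left (by linarith), mul_zero]

theorem cutoffMul_apply {n : ℕ} (f : MvPolynomial (Fin n) ℝ) (k : ℕ) (x : Fin n → ℝ) :
    cutoffMul f k x = eval x f * cutoff k x := rfl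

/-- A linear functional on polynomials which is non-negative on non-negative polynomials extends
to pairs of a polynomial and a compactly supported function, with non-negative values on the pairs
whose sum is a non-negative function. -/
theorem exists_extension_compactlySupported {n : ℕ} (L : MvPolynomial (Fin n) ℝ →ₗ[ℝ] ℝ)
    (hL : ∀ f ∈ nonnegCone n, 0 ≤ L f) :
    ∃ Λ : C_c(Fin n → ℝ, ℝ) →ₗ[ℝ] ℝ, ∀ (f : MvPolynomial (Fin n) ℝ) (g : C_c(Fin n → ℝ, ℝ)),
      (∀ x, 0 ≤ eval x f + g x) → 0 ≤ L f + Λ g := by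
  -- Using the product rather than a space of functions avoids asking whether polynomials and
  -- compactly supported functions intersect trivially.
  let s : PointedCone ℝ (MvPolynomial (Fin n) ℝ × C_c(Fin n → ℝ, ℝ)) :=
    { carrier := {p | ∀ x, 0 ≤ eval x p.1 + p.2 x}
      zero_mem' := fun x => by simp
      add_mem' := fun {p q} hp hq x => by
        have h1 := hp x
        have h2 := hq x
        simp only [Prod.fst_add, Prod.snd_add, map_add, CompactlySupportedContinuousMap.add_apply]
        linarith
      smul_mem' := fun ⟨c, hc⟩ p hp x => by
        have h := mul_nonneg hc (hp x)
        rw [mul_add] at h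
        simpa [MvPolynomial.smul_eval, Nonneg.mk_smul] using h }
  obtain ⟨G, hG, hGs⟩ := riesz_extension s
    ((L ∘ₗ LinearMap.fst ℝ _ _).toPMap (LinearMap.ker (LinearMap.snd ℝ _ _))) (by
      rintro ⟨⟨f, g⟩, hg⟩ hfg
      have hg' : g = 0 := hg
      subst hg'
      refine hL f fun x => ?_
      simpa using hfg x) (by
      rintro ⟨f, g⟩
      obtain ⟨M, hM⟩ := g.hasCompactSupport.exists_bound_of_continuous g.continuous
      -- Cofinality for the Riesz extension: adding this element of the domain leaves `M + g`,
      -- non-negative because `M` bounds `|g|`.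
      refine ⟨⟨(C M - f, 0), by simp⟩, fun x => ?_⟩
      have h := neg_le_of_abs_le (hM x)
      simp only [Prod.fst_add, Prod.snd_add, map_add, map_sub, eval_C, zero_add]
      linarith)
  refine ⟨G ∘ₗ LinearMap.inr ℝ _ _, fun f g hfg => ?_⟩
  have h1 := hGs (f, g) hfg
  have h2 : G (f, 0) = L f := hG ⟨(f, 0), by simp⟩
  have h3 : ((f, g) : MvPolynomial (Fin n) ℝ × C_c(Fin n → ℝ, ℝ)) = (f, 0) + (0, g) := by simp
  rw [h3, map_add, h2] at h1
  exact h1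

/-- **Haviland's theorem** on `ℝⁿ`: a linear functional on polynomials which is non-negative on
non-negative polynomials is the integral with respect to a measure. -/
theorem exists_measure_integral_eval_eq {n : ℕ} (L : MvPolynomial (Fin n) ℝ →ₗ[ℝ] ℝ)
    (hL : ∀ f ∈ nonnegCone n, 0 ≤ L f) :
    ∃ μ : Measure (Fin n → ℝ), ∀ f : MvPolynomial (Fin n) ℝ,
      Integrable (fun t => eval t f) μ ∧ ∫ t, eval t f ∂μ = L f := by
  obtain ⟨Λ₀, hΛ₀⟩ := exists_extension_compactlySupported L hL
  let Λ : C_c(Fin n → ℝ, ℝ) →ₚ[ℝ] ℝ := PositiveLinearMap.mk₀ Λ₀ fun g hg => by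
    simpa using hΛ₀ 0 g fun x => by simpa using hg x
  have hΛ : ∀ (f : MvPolynomial (Fin n) ℝ) (g : C_c(Fin n → ℝ, ℝ)),
      (∀ x, 0 ≤ eval x f + g x) → 0 ≤ L f + Λ g := hΛ₀
  have hlim : ∀ f ∈ nonnegCone n, Tendsto (fun k => Λ (cutoffMul f k)) atTop (𝓝 (L f)) := by
    intro f hf
    refine tendsto_of_tendsto_of_tendsto_of_le_of_le (g := fun k : ℕ =>
      L f - L (f * sumSq n) * (1 / ((k : ℝ) + 1))) (h := fun _ => L f) ?_ tendsto_const_nhds ?_ ?_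
    · simpa using ((tendsto_one_div_add_atTop_nhds_zero_nat (𝕜 := ℝ)).const_mul
        (L (f * sumSq n))).const_sub (L f)
    · intro k
      -- The error `f - f · cutoff k` is at most `f · sumSq / (k + 1)`, so no mass is lost at
      -- infinity.
      have h := hΛ ((1 / ((k : ℝ) + 1)) • (f * sumSq n) - f) (cutoffMul f k) fun x => by
        have h1 := mul_le_mul_of_nonneg_left (one_sub_cutoff_le k x) (hf x)
        simp only [map_sub, smul_eval, map_mul, cutoffMul_apply]
        have h2 : 1 / ((k : ℝ) + 1) * (eval x f * eval x (sumSq n)) =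
          eval x f * (eval x (sumSq n) / (k + 1)) := by ring
        rw [h2]
        linarith
      rw [map_sub, map_smul, smul_eq_mul] at h
      dsimp only
      linarith
    · intro k
      have h := hΛ f (-cutoffMul f k) fun x => by
        have h1 := mul_le_mul_of_nonneg_left (cutoff_le_one k x) (hf x)
        simp only [CompactlySupportedContinuousMap.neg_apply, cutoffMul_apply]
        linarith
      rw [map_neg] at h
      dsimp only
      linarith
  have hmain : ∀ f ∈ nonnegCone n, Integrable (fun t => eval t f) (RealRMK.rieszMeasure Λ) ∧
      ∫ t, eval t f ∂(RealRMK.rieszMeasure Λ) = L f := by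
    intro f hf
    have hg : ∀ k x, 0 ≤ cutoffMul f k x := fun k x => mul_nonneg (hf x) (cutoff_nonneg k x)
    have h1 : ∀ k, ∫⁻ x, ENNReal.ofReal (cutoffMul f k x) ∂(RealRMK.rieszMeasure Λ) =
        ENNReal.ofReal (Λ (cutoffMul f k)) := by
      intro k
      rw [← RealRMK.integral_rieszMeasure Λ, ofReal_integral_eq_lintegral_ofReal]
      · exact (cutoffMul f k).continuous.integrable_of_hasCompactSupport
          (cutoffMul f k).hasCompactSupport
      · exact Eventually.of_forall (hg k)
    -- Monotone convergence; comparison with `hlim` identifies the integral of `f` as `L f`.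
    have h2 : Tendsto (fun k => ∫⁻ x, ENNReal.ofReal (cutoffMul f k x) ∂(RealRMK.rieszMeasure Λ))
        atTop (𝓝 (∫⁻ x, ENNReal.ofReal (eval x f) ∂(RealRMK.rieszMeasure Λ))) := by
      refine lintegral_tendsto_of_tendsto_of_monotone
        (fun k => (cutoffMul f k).continuous.measurable.ennreal_ofReal.aemeasurable) ?_ ?_
      · exact Eventually.of_forall fun x k l hkl =>
          ENNReal.ofReal_le_ofReal (mul_le_mul_of_nonneg_left (monotone_cutoff x hkl) (hf x))
      · refine Eventually.of_forall fun x => ENNReal.tendsto_ofReal ?_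
        simpa [cutoffMul_apply] using (tendsto_cutoff x).const_mul (eval x f)
    have h3 : ∫⁻ x, ENNReal.ofReal (eval x f) ∂(RealRMK.rieszMeasure Λ) =
        ENNReal.ofReal (L f) := by
      refine tendsto_nhds_unique h2 ?_
      simp only [h1]
      exact ENNReal.tendsto_ofReal (hlim f hf)
    have hm : AEStronglyMeasurable (fun t => eval t f) (RealRMK.rieszMeasure Λ) :=
      (MvPolynomial.continuous_eval f).aestronglyMeasurable
    refine ⟨⟨hm, ?_⟩, ?_⟩
    · rw [hasFiniteIntegral_iff_ofReal (Eventually.of_forall hf), h3]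
      exact ENNReal.ofReal_lt_top
    · rw [integral_eq_lintegral_of_nonneg_ae (Eventually.of_forall hf) hm, h3,
        ENNReal.toReal_ofReal (hL f hf)]
  refine ⟨RealRMK.rieszMeasure Λ, fun f => ?_⟩
  -- Any `f` is the difference of the squares of `(f + 1) / 2` and `(f - 1) / 2`.
  obtain ⟨i1, e1⟩ := hmain ((C (1 / 2) * (f + 1)) ^ 2) fun x => by
    rw [map_pow]; positivity
  obtain ⟨i2, e2⟩ := hmain ((C (1 / 2) * (f - 1)) ^ 2) fun x => by
    rw [map_pow]; positivity
  have hf : f = (C (1 / 2) * (f + 1)) ^ 2 - (C (1 / 2) * (f - 1)) ^ 2 := by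
    have : (C (1 / 2 : ℝ) : MvPolynomial (Fin n) ℝ) ^ 2 * 4 = 1 := by
      have h4 : (4 : MvPolynomial (Fin n) ℝ) = C 4 := (map_ofNat C 4).symm
      rw [h4, ← C_pow, ← C_mul, ← C_1]
      norm_num
    linear_combination (-f) * this
  generalize (C (1 / 2) * (f + 1)) ^ 2 = u at *
  generalize (C (1 / 2) * (f - 1)) ^ 2 = v at *
  subst hf
  simp only [map_sub]
  exact ⟨i1.sub i2, by rw [integral_sub i1 i2, e1, e2]⟩

end NonnegPreserver

namespace NonnegPreserver

/-! ### Translations and constant-coefficient operators -/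

/-- The translate `f(· + x)` of a polynomial. -/
noncomputable def translate {n : ℕ} (x : Fin n → ℝ) :
    MvPolynomial (Fin n) ℝ →ₐ[ℝ] MvPolynomial (Fin n) ℝ :=
  aeval fun i => X i + C (x i)

theorem eval_translate {n : ℕ} (x t : Fin n → ℝ) (f : MvPolynomial (Fin n) ℝ) :
    eval t (translate x f) = eval (t + x) f := by
  induction f using MvPolynomial.induction_on with
  | C a => simp [translate]
  | add p q hp hq => simp only [map_add, hp, hq]
  | mul_X p i hp => simp only [map_mul, hp]; simp [translate]

theorem translate_mem_nonnegCone {n : ℕ} (x : Fin n → ℝ) {f : MvPolynomial (Fin n) ℝ}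
    (hf : f ∈ nonnegCone n) : translate x f ∈ nonnegCone n := fun t => by
  rw [eval_translate]
  exact hf _

theorem pderiv_translate {n : ℕ} (x : Fin n → ℝ) (i : Fin n) (f : MvPolynomial (Fin n) ℝ) :
    pderiv i (translate x f) = translate x (pderiv i f) := by
  induction f using MvPolynomial.induction_on with
  | C a => simp [translate]
  | add p q hp hq => simp only [map_add, hp, hq]
  | mul_X p j hp =>
    have hX : translate x (X j) = X j + C (x j) := by simp [translate]
    simp only [map_mul, pderiv_mul, hp, map_add, hX, pderiv_C, add_zero]
    congr 2
    by_cases h : j = i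
    · subst h; simp
    · simp [pderiv_X_of_ne h]

theorem multiDeriv_translate {n : ℕ} (x : Fin n → ℝ) (α : Fin n →₀ ℕ)
    (f : MvPolynomial (Fin n) ℝ) :
    multiDeriv α (translate x f) = translate x (multiDeriv α f) := by
  have hpow : ∀ (i : Fin n) (k : ℕ) (g : MvPolynomial (Fin n) ℝ),
      (((pderiv i : Derivation ℝ (MvPolynomial (Fin n) ℝ) (MvPolynomial (Fin n) ℝ)) :
        Module.End ℝ (MvPolynomial (Fin n) ℝ)) ^ k) (translate x g) = translate x
      ((((pderiv i : Derivation ℝ (MvPolynomial (Fin n) ℝ) (MvPolynomial (Fin n) ℝ)) :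
        Module.End ℝ (MvPolynomial (Fin n) ℝ)) ^ k) g) := by
    intro i k g
    induction k with
    | zero => simp
    | succ k ih =>
      rw [pow_succ', Module.End.mul_apply, ih, Module.End.mul_apply]
      exact pderiv_translate x i _
  rw [multiDeriv]
  induction List.finRange n with
  | nil => simp
  | cons i l ih =>
    rw [List.map_cons, List.prod_cons, Module.End.mul_apply, ih, hpow, Module.End.mul_apply]

theorem diffOp_apply {n : ℕ} (q : (Fin n →₀ ℕ) → MvPolynomial (Fin n) ℝ)
    (f : MvPolynomial (Fin n) ℝ) : diffOp q f = ∑ᶠ α, q α * multiDeriv α f := rfl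

theorem diffOp_C_translate {n : ℕ} (c : (Fin n →₀ ℕ) → ℝ) (x : Fin n → ℝ)
    (f : MvPolynomial (Fin n) ℝ) :
    diffOp (fun α => C (c α)) (translate x f) = translate x (diffOp (fun α => C (c α)) f) := by
  rw [diffOp_apply, diffOp_apply]
  refine Eq.trans (finsum_congr fun α => ?_)
    ((translate x).toLinearMap.toAddMonoidHom.map_finsum (finite_support_term _ f)).symm
  rw [multiDeriv_translate]
  show _ = translate x _
  rw [map_mul]
  simp [translate]

/-! ### The moment functional, its values on monomials and the Fischer–Fock pairing -/

variable {n : ℕ} (T : MvPolynomial (Fin n) ℝ →ₗ[ℝ] MvPolynomial (Fin n) ℝ)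

theorem eval_diffOp (q : (Fin n →₀ ℕ) → MvPolynomial (Fin n) ℝ) (y : Fin n → ℝ)
    (f : MvPolynomial (Fin n) ℝ) :
    eval y (diffOp q f) = ∑ᶠ α, eval y (q α) * eval y (multiDeriv α f) := by
  rw [diffOp_apply]
  refine ((eval y).toAddMonoidHom.map_finsum (finite_support_term q f)).trans ?_
  exact finsum_congr fun α => map_mul (eval y) _ _

theorem eval_frozenOp_self (y : Fin n → ℝ) (f : MvPolynomial (Fin n) ℝ) :
    eval y (frozenOp T y f) = eval y (T f) := by
  conv_rhs => rw [eq_diffOp_symbolCoeff T]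
  rw [frozenOp, eval_diffOp, eval_diffOp]
  simp only [eval_C]

/-- The functional `f ↦ (T_y f)(0)`. -/
noncomputable def momentFunctional (y : Fin n → ℝ) : MvPolynomial (Fin n) ℝ →ₗ[ℝ] ℝ :=
  (aeval (0 : Fin n → ℝ)).toLinearMap ∘ₗ frozenOp T y

theorem momentFunctional_apply (y : Fin n → ℝ) (f : MvPolynomial (Fin n) ℝ) :
    momentFunctional T y f = eval 0 (frozenOp T y f) := by
  simp [momentFunctional]

theorem eval_frozenOp (y x : Fin n → ℝ) (f : MvPolynomial (Fin n) ℝ) :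
    eval x (frozenOp T y f) = momentFunctional T y (translate x f) := by
  rw [momentFunctional_apply, frozenOp, diffOp_C_translate, eval_translate, zero_add]

theorem momentFunctional_monomial (y : Fin n → ℝ) (β : Fin n →₀ ℕ) :
    momentFunctional T y (monomial β 1) = hankelMap T y β := by
  rw [momentFunctional_apply, frozenOp, diffOp_monomial, map_add, map_sum,
    Finset.sum_eq_zero, add_zero, hankelMap, map_mul, eval_C, eval_C, mul_comm]
  intro α hα
  -- For `α < β` the derivative still contains a variable, hence vanishes at `0`; only `α = β`
  -- contributes.
  have hne : β - α ≠ 0 := fun h => (Finset.mem_Iio.1 hα).not_ge (tsub_eq_zero_iff_le.1 h)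
  obtain ⟨i, hi⟩ := Finsupp.ne_iff.1 hne
  have hz : ∏ j, (0 : Fin n → ℝ) j ^ (β - α) j = 0 :=
    Finset.prod_eq_zero (Finset.mem_univ i) (zero_pow hi)
  rw [map_mul, multiDeriv_monomial, eval_monomial, Finsupp.prod_fintype _ _ (by simp), hz,
    mul_zero, mul_zero]

theorem momentFunctional_eq_sum (y : Fin n → ℝ) (f : MvPolynomial (Fin n) ℝ) :
    momentFunctional T y f = ∑ β ∈ f.support, f.coeff β * hankelMap T y β := by
  conv_lhs => rw [f.as_sum]
  rw [map_sum]
  refine Finset.sum_congr rfl fun β _ => ?_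
  rw [← momentFunctional_monomial, ← smul_eq_mul, ← map_smul, smul_monomial, smul_eq_mul, mul_one]

theorem eval_monomial_one (t : Fin n → ℝ) (α : Fin n →₀ ℕ) :
    eval t (monomial α (1 : ℝ)) = ∏ i, t i ^ α i := by
  rw [eval_monomial, Finsupp.prod_fintype _ _ (by simp), one_mul]

theorem coeff_truncatedSymbol (y : Fin n → ℝ) (α β : Fin n →₀ ℕ) :
    (truncatedSymbol T y α).coeff β = if β ≤ α then eval y (symbolCoeff T β) else 0 := by
  classical
  simp [truncatedSymbol, coeff_sum, coeff_monomial]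

theorem fischerInner_eq_sum (f g : MvPolynomial (Fin n) ℝ) {s : Finset (Fin n →₀ ℕ)}
    (hs : f.support ⊆ s) :
    fischerInner f g = ∑ α ∈ s, (multiFactorial α : ℝ) * f.coeff α * g.coeff α := by
  refine Finset.sum_subset hs fun α _ hα => ?_
  rw [notMem_support_iff.1 hα, mul_zero, zero_mul]

theorem fischerInner_truncatedSymbol (y : Fin n → ℝ) {α : Fin n →₀ ℕ}
    {f : MvPolynomial (Fin n) ℝ} (hf : ∀ i, f.degreeOf i ≤ α i) :
    fischerInner (truncatedSymbol T y α) f = momentFunctional T y f := by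
  have h1 : (truncatedSymbol T y α).support ⊆ Finset.Iic α := fun β hβ => by
    rw [mem_support_iff, coeff_truncatedSymbol] at hβ
    exact Finset.mem_Iic.2 (of_not_not fun h => hβ (if_neg h))
  have h2 : f.support ⊆ Finset.Iic α := fun β hβ =>
    Finset.mem_Iic.2 fun i => (degreeOf_le_iff.1 (hf i)) β hβ
  rw [fischerInner_eq_sum _ _ h1, momentFunctional_eq_sum]
  symm
  rw [Finset.sum_subset h2 fun β _ hβ => by rw [notMem_support_iff.1 hβ, zero_mul]]
  refine Finset.sum_congr rfl fun β hβ => ?_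
  rw [coeff_truncatedSymbol, if_pos (Finset.mem_Iic.1 hβ), hankelMap]
  ring

theorem momentFunctional_eq_integral {μ : Measure (Fin n → ℝ)} {y : Fin n → ℝ}
    (hμ : HasFiniteMoments μ)
    (h : ∀ α : Fin n →₀ ℕ, hankelMap T y α = ∫ t, ∏ i, t i ^ α i ∂μ)
    (f : MvPolynomial (Fin n) ℝ) :
    Integrable (fun t => eval t f) μ ∧ momentFunctional T y f = ∫ t, eval t f ∂μ := by
  have he : ∀ t, eval t f = ∑ β ∈ f.support, f.coeff β * ∏ i, t i ^ β i := fun t => by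
    rw [eval_eq']
  have hi : ∀ β ∈ f.support, Integrable (fun t : Fin n → ℝ => f.coeff β * ∏ i, t i ^ β i) μ :=
    fun β _ => (hμ β).const_mul _
  simp only [he]
  refine ⟨integrable_finsetSum _ hi, ?_⟩
  rw [integral_finsetSum _ hi, momentFunctional_eq_sum]
  exact Finset.sum_congr rfl fun β _ => by rw [h, integral_const_mul]

/-! ### Each condition as positivity of the moment functionals -/

theorem frozenOp_preserves_iff :
    (∀ y : Fin n → ℝ, ∀ f ∈ nonnegCone n, frozenOp T y f ∈ nonnegCone n) ↔
      ∀ y : Fin n → ℝ, ∀ f ∈ nonnegCone n, 0 ≤ momentFunctional T y f := by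
  refine forall_congr' fun y => ⟨fun h f hf => ?_, fun h f hf x => ?_⟩
  · rw [momentFunctional_apply]
    exact h f hf 0
  · rw [eval_frozenOp]
    exact h _ (translate_mem_nonnegCone x hf)

theorem preserves_iff :
    (∀ f ∈ nonnegCone n, T f ∈ nonnegCone n) ↔
      ∀ y : Fin n → ℝ, ∀ f ∈ nonnegCone n, 0 ≤ momentFunctional T y f := by
  have key : ∀ (y : Fin n → ℝ) f, eval y (T f) = momentFunctional T y (translate y f) :=
    fun y f => by rw [← eval_frozenOp_self, eval_frozenOp]
  refine ⟨fun h y f hf => ?_, fun h f hf y => ?_⟩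
  · have h1 := h _ (translate_mem_nonnegCone (-y) hf) y
    have h2 : translate y (translate (-y) f) = f :=
      MvPolynomial.funext fun t => by rw [eval_translate, eval_translate, add_neg_cancel_right]
    rwa [key, h2] at h1
  · rw [key]
    exact h y _ (translate_mem_nonnegCone y hf)

theorem truncatedSymbol_mem_fischerDual_iff :
    (∀ (y : Fin n → ℝ) (α : Fin n →₀ ℕ),
      truncatedSymbol T y (2 • α) ∈ fischerDual (nonnegConeLE (2 • α))) ↔
      ∀ y : Fin n → ℝ, ∀ f ∈ nonnegCone n, 0 ≤ momentFunctional T y f := by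
  refine forall_congr' fun y => ⟨fun h f hf => ?_, fun h α f hf => ?_⟩
  -- Even bounds lose nothing: twice the multi-index of partial degrees already dominates `f`.
  · have hd : ∀ i, f.degreeOf i ≤ (2 • Finsupp.equivFunOnFinite.symm fun j => f.degreeOf j) i :=
      fun i => by simp; omega
    rw [← fischerInner_truncatedSymbol T y hd]
    exact h _ f ⟨hf, hd⟩
  · rw [fischerInner_truncatedSymbol T y hf.2]
    exact h f hf.1

theorem exists_isMomentFamily_iff :
    (∃ μ : (Fin n → ℝ) → Measure (Fin n → ℝ), IsMomentFamily T μ) ↔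
      ∀ y : Fin n → ℝ, ∀ f ∈ nonnegCone n, 0 ≤ momentFunctional T y f := by
  refine ⟨?_, fun h => ?_⟩
  · rintro ⟨μ, hμ, -, hH⟩ y f hf
    rw [(momentFunctional_eq_integral T (hμ y) (hH y) f).2]
    exact integral_nonneg hf
  · choose μ hμ using fun y => exists_measure_integral_eval_eq (momentFunctional T y) (h y)
    have hint : ∀ y α, ∫ t, ∏ i, t i ^ α i ∂(μ y) = hankelMap T y α := fun y α => by
      rw [← momentFunctional_monomial, ← (hμ y _).2]
      simp only [eval_monomial_one]
    refine ⟨μ, fun s α => ?_, fun α => ⟨C (multiFactorial α : ℝ) * symbolCoeff T α, fun s => ?_⟩,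
      fun y α => (hint y α).symm⟩
    · simpa only [eval_monomial_one] using (hμ s (monomial α 1)).1
    · rw [hint, hankelMap, map_mul, eval_C]

/-- The quadratic form at `v` is `L_y` applied to the square of `∑ i, v_i x^{α_i}`. -/
theorem posSemidef_hankelMap {y : Fin n → ℝ}
    (h : ∀ f ∈ nonnegCone n, 0 ≤ momentFunctional T y f) {m : ℕ} (α : Fin m → (Fin n →₀ ℕ)) :
    (Matrix.of fun i j => hankelMap T y (α i + α j)).PosSemidef := by
  refine Matrix.PosSemidef.of_dotProduct_mulVec_nonneg ?_ fun v => ?_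
  · exact Matrix.IsHermitian.ext fun i j => by simp [add_comm (α i)]
  · have h1 := h ((∑ i, monomial (α i) (v i)) ^ 2) fun x => by
      rw [map_pow]; positivity
    have h2 : ∀ (β : Fin n →₀ ℕ) (c : ℝ),
        momentFunctional T y (monomial β c) = c * hankelMap T y β := fun β c => by
      rw [← momentFunctional_monomial, ← smul_eq_mul, ← map_smul, smul_monomial, smul_eq_mul,
        mul_one]
    rw [sq, Finset.sum_mul_sum] at h1
    simp only [monomial_mul, map_sum, h2] at h1
    refine h1.trans_eq ?_
    simp only [dotProduct, Matrix.mulVec, Matrix.of_apply, Finset.mul_sum, Pi.star_apply,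
      star_trivial]
    exact Finset.sum_congr rfl fun i _ => Finset.sum_congr rfl fun j _ => by ring

end NonnegPreserver

theorem theorem3p1 (n : ℕ)
    (T : MvPolynomial (Fin n) ℝ →ₗ[ℝ] MvPolynomial (Fin n) ℝ) :
    List.TFAE [
      ∀ f ∈ NonnegPreserver.nonnegCone n, T f ∈ NonnegPreserver.nonnegCone n,
      ∀ y : Fin n → ℝ, ∀ f ∈ NonnegPreserver.nonnegCone n,
        NonnegPreserver.frozenOp T y f ∈ NonnegPreserver.nonnegCone n,
      ∀ (y : Fin n → ℝ) (α : Fin n →₀ ℕ),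
        NonnegPreserver.truncatedSymbol T y (2 • α) ∈
          NonnegPreserver.fischerDual (NonnegPreserver.nonnegConeLE (2 • α)),
      ∃ μ : (Fin n → ℝ) → Measure (Fin n → ℝ), NonnegPreserver.IsMomentFamily T μ] ∧
    (∀ μ : (Fin n → ℝ) → Measure (Fin n → ℝ), NonnegPreserver.IsMomentFamily T μ →
      ∀ (y : Fin n → ℝ) (f : MvPolynomial (Fin n) ℝ) (x : Fin n → ℝ),
        Integrable (fun t : Fin n → ℝ => eval (t + x) f) (μ y) ∧
        eval x (NonnegPreserver.frozenOp T y f) = ∫ t, eval (t + x) f ∂(μ y)) ∧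
    ((∀ f ∈ NonnegPreserver.nonnegCone n, T f ∈ NonnegPreserver.nonnegCone n) →
      ∀ (y : Fin n → ℝ) (m : ℕ) (α : Fin m → (Fin n →₀ ℕ)),
        (Matrix.of fun i j => NonnegPreserver.hankelMap T y (α i + α j)).PosSemidef) := by
  refine ⟨?_, fun μ hμ y f x => ?_, fun h y m α => ?_⟩
  · refine List.tfae_of_forall (∀ y : Fin n → ℝ, ∀ f ∈ NonnegPreserver.nonnegCone n,
      0 ≤ NonnegPreserver.momentFunctional T y f) _ ?_
    rw [NonnegPreserver.preserves_iff, NonnegPreserver.frozenOp_preserves_iff,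
      NonnegPreserver.truncatedSymbol_mem_fischerDual_iff,
      NonnegPreserver.exists_isMomentFamily_iff]
    simp
  · rw [NonnegPreserver.eval_frozenOp]
    simpa only [NonnegPreserver.eval_translate] using
      NonnegPreserver.momentFunctional_eq_integral T (hμ.1 y) (hμ.2.2 y)
        (NonnegPreserver.translate x f)
  · exact NonnegPreserver.posSemidef_hankelMap T ((NonnegPreserver.preserves_iff T).1 h y) α
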